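/- An entire function $G:\mathbb{C}\to\mathbb{C}$ has exponential type at most $\tau$ if for every $\varepsilon>0$ there is a constant $C_\varepsilon>0$ with $|G(z)|\le C_\varepsilon e^{(\tau+\varepsilon)|z|}$ for all $z\in\mathbb{C}$. Let $PW^2$ be the space of entire functions $g:\mathbb{C}\to\mathbb{C}$ of exponential type at most $\pi$ whose restriction to $\mathbb{R}$ belongs to $L^2(\mathbb{R})$. Then the following hold. (i) Fix $0<a<1/\pi^2$. For every $g\in PW^2$ with $g(0)=1$, the function $|g'|^2$ is integrable on $\mathbb{R}$ and $$ a\int_{-\infty}^{\infty}|g'(x)|^2\,dx+\left(\frac{1}{2\pi\sqrt a}\,\log\left(\frac{1+\sqrt a\,\pi}{1-\sqrt a\,\pi}\right)\right)^{-1}\le\int_{-\infty}^{\infty}|g(x)|^2\,dx . $$ (ii) ($L^2$ Bernstein inequality.) For every $g\in PW^2$ (in particular for every $g \in PW^2$ with $g(0)=1$), the function $|g'|^2$ is integrable on $\mathbb{R}$ and $$ \int_{-\infty}^{\infty}|g'(x)|^2\,dx\le\pi^2\int_{-\infty}^{\infty}|g(x)|^2\,dx . $$ -/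

import Mathlib

open MeasureTheory

/-- `G : ℂ → ℂ` is an entire function of exponential type at most `τ`. -/
def EntireExpTypeAtMost (τ : ℝ) (G : ℂ → ℂ) : Prop :=
  Differentiable ℂ G ∧
    ∀ ε : ℝ, 0 < ε → ∃ C : ℝ, 0 < C ∧ ∀ z : ℂ, ‖G z‖ ≤ C * Real.exp ((τ + ε) * ‖z‖)

/-- The Paley-Wiener space `PW²`: the entire functions of exponential type at most `π`
whose restriction to the real line is in `L²(ℝ)`. -/
def PaleyWiener2 : Set (ℂ → ℂ) :=
  {g | EntireExpTypeAtMost Real.pi g ∧ MemLp (fun x : ℝ => g (x : ℂ)) 2 volume}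

/-! On the line, `g` is the inverse Fourier transform of some `u` in `L²` supported in `[-1/2, 1/2]`
(`exists_spectrum`). By Plancherel `∫|g|² = ∫|u|²` and `∫|g'|² = ∫(2πξ)²|u|²`, while `g 0 = ∫u`.
Bernstein's inequality is then `|2πξ| ≤ π` on the support. For (i), put `p(ξ) = 1 - a(2πξ)²`,
positive on the support because `a < 1/π²`; Cauchy-Schwarz gives `|∫u|² ≤ ∫p⁻¹ · ∫p|u|²`, and `∫p⁻¹`
is the logarithmic constant.

The support statement rests on the bound `|g z| ≤ C(1+|z|)exp(π|Im z|)`. Dividing by `(z ∓ i)³`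
makes `g` integrable, and a contour in the lower or upper half-plane shows that the transform of the
quotient vanishes for `|ξ| ≥ 1/2`. On the Fourier side the division is undone by a differential
operator, which does not enlarge supports. -/

/-! ### Growth bounds in the plane. -/

theorem EntireExpTypeAtMost.comp_neg {τ : ℝ} {F : ℂ → ℂ} (hF : EntireExpTypeAtMost τ F) :
    EntireExpTypeAtMost τ (fun z => F (-z)) := by
  refine ⟨hF.1.comp differentiable_neg, fun ε hε => ?_⟩
  obtain ⟨C, hC, h⟩ := hF.2 ε hε
  exact ⟨C, hC, fun z => by simpa using h (-z)⟩

/-- Phragmén-Lindelöf in the right half-plane for `F(iw) exp(-(τ+ε)w) / (1+w)`: the exponential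
tames the positive axis, the denominator the linear growth on the boundary. Finally `ε → 0`. -/
theorem norm_le_of_linear_growth_upper {τ A : ℝ} (hτ : 0 ≤ τ) (hA : 0 ≤ A) {F : ℂ → ℂ}
    (hF : EntireExpTypeAtMost τ F) (hR : ∀ x : ℝ, ‖F x‖ ≤ A * (1 + |x|)) {w : ℂ}
    (hw : 0 ≤ w.re) :
    ‖F (Complex.I * w)‖ ≤ 2 * A * (1 + ‖w‖) * Real.exp (τ * w.re) := by
  have hne : ∀ v : ℂ, 0 ≤ v.re → 1 ≤ ‖1 + v‖ := fun v hv => by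
    have := Complex.re_le_norm (1 + v)
    simp at this
    linarith
  have hne0 : ∀ v : ℂ, 0 ≤ v.re → (1 + v) ≠ 0 := fun v hv h => by
    have := hne v hv
    rw [h] at this
    simp at this
    linarith
  have key : ∀ ε : ℝ, 0 < ε →
      ‖F (Complex.I * w)‖ ≤ 2 * A * (1 + ‖w‖) * Real.exp ((τ + ε) * w.re) := by
    intro ε hε
    obtain ⟨C, hC, hCF⟩ := hF.2 ε hε
    set f : ℂ → ℂ := fun v => F (Complex.I * v) * Complex.exp (-((τ + ε : ℝ) : ℂ) * v) / (1 + v)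
      with hf
    have hfn : ∀ v : ℂ, ‖f v‖ =
        ‖F (Complex.I * v)‖ * Real.exp (-((τ + ε) * v.re)) / ‖1 + v‖ := by
      intro v
      rw [hf]
      simp only [norm_div, norm_mul, Complex.norm_exp]
      congr 3
      rw [← Complex.ofReal_neg, Complex.re_ofReal_mul]
      ring
    have hb : ‖f w‖ ≤ 2 * A := by
      refine PhragmenLindelof.right_half_plane_of_bounded_on_real ?_ ?_ ?_ ?_ hw
      · apply DifferentiableOn.diffContOnCl
        have hcl : closure {z : ℂ | 0 < z.re} = {z : ℂ | 0 ≤ z.re} := Complex.closure_setOfPred_lt_re 0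
        rw [hcl]
        intro v hv
        apply DifferentiableAt.differentiableWithinAt
        have h1 := hF.1
        refine DifferentiableAt.div ?_ (by fun_prop) (hne0 v hv)
        exact ((h1.comp (differentiable_id.const_mul _)) v).mul (by fun_prop)
      · refine ⟨1, by norm_num, τ + ε, ?_⟩
        refine Asymptotics.IsBigO.of_bound C ?_
        refine Filter.eventually_inf_principal.2 <| Filter.Eventually.of_forall fun v hv => ?_
        have hv' : 0 ≤ v.re := le_of_lt hv
        rw [hfn, Real.rpow_one, Real.norm_of_nonneg (Real.exp_pos _).le]
        have h1 := hCF (Complex.I * v)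
        rw [norm_mul, Complex.norm_I, one_mul] at h1
        have h2 : Real.exp (-((τ + ε) * v.re)) ≤ 1 := by
          rw [Real.exp_le_one_iff]
          have : 0 ≤ (τ + ε) * v.re := by positivity
          linarith
        calc _ ≤ ‖F (Complex.I * v)‖ * Real.exp (-((τ + ε) * v.re)) :=
              div_le_self (by positivity) (hne v hv')
          _ ≤ ‖F (Complex.I * v)‖ := mul_le_of_le_one_right (norm_nonneg _) h2
          _ ≤ _ := h1
      · refine ⟨C, Filter.eventually_map.2 ?_⟩
        filter_upwards [Filter.eventually_ge_atTop 0] with x hx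
        rw [hfn]
        have h1 := hCF (Complex.I * x)
        rw [norm_mul, Complex.norm_I, one_mul, Complex.norm_of_nonneg hx] at h1
        refine (div_le_self (by positivity) (hne x (by simpa using hx))).trans ?_
        rw [Real.exp_neg, ← div_eq_mul_inv, div_le_iff₀ (Real.exp_pos _)]
        simpa using h1
      · intro y
        rw [hfn]
        have h1 := hR (-y)
        have e : Complex.I * (y * Complex.I) = ((-y : ℝ) : ℂ) := by
          push_cast
          linear_combination (y : ℂ) * Complex.I_mul_I
        rw [e]
        -- Both `1` and `|y|` are at most `|1 + iy|`, whence the factor 2 in `2 * A`.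
        have h2 := hne (y * Complex.I) (by simp)
        have h3 := Complex.abs_im_le_norm (1 + y * Complex.I)
        simp only [Complex.add_im, Complex.one_im, Complex.mul_im, Complex.ofReal_re,
          Complex.I_im, Complex.ofReal_im, Complex.I_re, mul_one, mul_zero, zero_add,
          add_zero] at h3
        rw [div_le_iff₀ (by linarith)]
        simp only [Complex.mul_re, Complex.ofReal_re, Complex.I_re, Complex.ofReal_im,
          Complex.I_im, mul_zero, sub_zero, neg_zero, Real.exp_zero, mul_one]
        rw [abs_neg] at h1
        nlinarith
    rw [hfn, div_le_iff₀ (by linarith [hne w hw]), Real.exp_neg, ← div_eq_mul_inv,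
      div_le_iff₀ (Real.exp_pos _)] at hb
    refine hb.trans ?_
    have : ‖1 + w‖ ≤ 1 + ‖w‖ := by simpa using norm_add_le 1 w
    gcongr
  have ht : Filter.Tendsto (fun ε : ℝ => 2 * A * (1 + ‖w‖) * Real.exp ((τ + ε) * w.re))
      (nhdsWithin 0 (Set.Ioi 0)) (nhds (2 * A * (1 + ‖w‖) * Real.exp (τ * w.re))) := by
    refine Filter.Tendsto.mono_left ?_ nhdsWithin_le_nhds
    exact Continuous.tendsto' (by fun_prop) _ _ (by simp)
  exact ge_of_tendsto ht (Filter.eventually_of_mem self_mem_nhdsWithin key)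

theorem norm_le_of_linear_growth {τ A : ℝ} (hτ : 0 ≤ τ) (hA : 0 ≤ A) {F : ℂ → ℂ}
    (hF : EntireExpTypeAtMost τ F) (hR : ∀ x : ℝ, ‖F x‖ ≤ A * (1 + |x|)) (z : ℂ) :
    ‖F z‖ ≤ 2 * A * (1 + ‖z‖) * Real.exp (τ * |z.im|) := by
  rcases le_total 0 z.im with h | h
  · have := norm_le_of_linear_growth_upper hτ hA hF hR (w := -(Complex.I * z)) (by simpa using h)
    have e : Complex.I * -(Complex.I * z) = z := by
      linear_combination (-z) * Complex.I_mul_I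
    rw [e] at this
    simpa [abs_of_nonneg h] using this
  · have := norm_le_of_linear_growth_upper hτ hA hF.comp_neg
      (fun x => by simpa using hR (-x)) (w := Complex.I * z) (by simpa using h)
    have e : -(Complex.I * (Complex.I * z)) = z := by
      linear_combination (-z) * Complex.I_mul_I
    rw [e] at this
    simpa [abs_of_nonpos h] using this

theorem EntireExpTypeAtMost.exists_primitive {τ : ℝ} (hτ : 0 ≤ τ) {g : ℂ → ℂ}
    (hg : EntireExpTypeAtMost τ g) :
    ∃ F : ℂ → ℂ, F 0 = 0 ∧ (∀ z, HasDerivAt F (g z) z) ∧ EntireExpTypeAtMost τ F := by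
  obtain ⟨F₀, hF₀⟩ := hg.1.isExactOn_univ
  have hd : ∀ z, HasDerivAt (fun z => F₀ z - F₀ 0) (g z) z := fun z =>
    (hF₀ z (Set.mem_univ z)).sub_const _
  refine ⟨fun z => F₀ z - F₀ 0, by simp, hd, fun z => (hd z).differentiableAt, fun ε hε => ?_⟩
  -- The other half of `ε` absorbs the factor `‖z‖` produced by the mean value inequality.
  obtain ⟨C, hC, h⟩ := hg.2 (ε / 2) (by positivity)
  refine ⟨C * (2 / ε), by positivity, fun z => ?_⟩
  have h1 := (convex_closedBall (0 : ℂ) ‖z‖).norm_image_sub_le_of_norm_hasDerivWithin_le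
    (f := fun z => F₀ z - F₀ 0) (f' := g) (C := C * Real.exp ((τ + ε / 2) * ‖z‖)) (x := 0) (y := z)
    (fun x _ => (hd x).hasDerivWithinAt)
    (fun x hx => (h x).trans (by
      have : ‖x‖ ≤ ‖z‖ := by simpa using hx
      gcongr)) (by simp) (by simp)
  simp only [sub_self, sub_zero] at h1
  refine h1.trans ?_
  have h2 : ‖z‖ ≤ 2 / ε * Real.exp (ε / 2 * ‖z‖) := by
    have := Real.add_one_le_exp (ε / 2 * ‖z‖)
    rw [div_mul_eq_mul_div, le_div_iff₀ hε]
    linarith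
  calc _ ≤ C * Real.exp ((τ + ε / 2) * ‖z‖) * (2 / ε * Real.exp (ε / 2 * ‖z‖)) := by gcongr
    _ = C * (2 / ε) * (Real.exp ((τ + ε / 2) * ‖z‖) * Real.exp (ε / 2 * ‖z‖)) := by ring
    _ = _ := by rw [← Real.exp_add]; ring_nf

/-- Square integrability gives no immediate pointwise bound on `g`, but its primitive grows at most
linearly on the line, since `t ≤ 1 + t²`. Phragmén-Lindelöf applies to the primitive, and Cauchy's
estimate on unit circles returns to `g`. -/
theorem exists_norm_le_of_mem_PaleyWiener2 {g : ℂ → ℂ} (hg : g ∈ PaleyWiener2) :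
    ∃ C : ℝ, 0 ≤ C ∧ ∀ z, ‖g z‖ ≤ C * (1 + ‖z‖) * Real.exp (Real.pi * |z.im|) := by
  obtain ⟨F, hF0, hFd, hFt⟩ := hg.1.exists_primitive Real.pi_pos.le
  have hgc : Continuous fun x : ℝ => g x := hg.1.1.continuous.comp Complex.continuous_ofReal
  have hint : Integrable (fun x : ℝ => ‖g x‖ ^ 2) :=
    (memLp_two_iff_integrable_sq_norm hg.2.1).1 hg.2
  set K := ∫ x : ℝ, ‖g x‖ ^ 2
  have hK : 0 ≤ K := integral_nonneg fun x => by positivity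
  have hR : ∀ x : ℝ, ‖F x‖ ≤ (1 + K) * (1 + |x|) := by
    intro x
    have h1 : ∫ t in (0 : ℝ)..x, g t = F x := by
      have := intervalIntegral.integral_eq_sub_of_hasDerivAt (a := 0) (b := x)
        (f := fun t : ℝ => F t) (f' := fun t : ℝ => g t)
        (fun t _ => (hFd t).comp_ofReal) (hgc.intervalIntegrable _ _)
      simpa [hF0] using this
    rw [← h1]
    refine (intervalIntegral.norm_integral_le_integral_norm_uIoc).trans ?_
    have h2 : ∫ t in Set.uIoc 0 x, ‖g t‖ ≤ ∫ t in Set.uIoc 0 x, (1 + ‖g t‖ ^ 2) := by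
      have hfin : IntegrableOn (fun _ : ℝ => (1 : ℝ)) (Set.uIoc 0 x) := by simp [Set.uIoc]
      refine setIntegral_mono ?_ (hfin.add hint.integrableOn)
        fun t => by nlinarith [norm_nonneg (g t), sq_nonneg (‖g t‖ - 1)]
      exact ((hgc.norm.intervalIntegrable 0 x).def')
    have hfin : IntegrableOn (fun _ : ℝ => (1 : ℝ)) (Set.uIoc 0 x) := by simp [Set.uIoc]
    rw [integral_add hfin hint.integrableOn] at h2
    have h3 : ∫ t in Set.uIoc 0 x, ‖g t‖ ^ 2 ≤ K :=
      setIntegral_le_integral hint (Filter.Eventually.of_forall fun t => by positivity)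
    have h4 : ∫ t in Set.uIoc 0 x, (1 : ℝ) = |x| := by simp [Measure.real, Real.volume_uIoc]
    rw [h4] at h2
    nlinarith [abs_nonneg x]
  have hF := norm_le_of_linear_growth Real.pi_pos.le (by positivity) hFt hR
  refine ⟨4 * (1 + K) * Real.exp Real.pi, by positivity, fun z => ?_⟩
  rw [← (hFd z).deriv]
  have hdc : DiffContOnCl ℂ F (Metric.ball z 1) := hFt.1.diffContOnCl
  have := Complex.norm_deriv_le_of_forall_mem_sphere_norm_le (c := z) one_pos hdc
    (C := 4 * (1 + K) * Real.exp Real.pi * (1 + ‖z‖) * Real.exp (Real.pi * |z.im|)) ?_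
  · simpa using this
  intro w hw
  have hw1 : ‖w - z‖ = 1 := by simpa [dist_eq_norm] using hw
  have hw2 : ‖w‖ ≤ 1 + ‖z‖ := by
    calc ‖w‖ = ‖(w - z) + z‖ := by simp
      _ ≤ _ := hw1 ▸ norm_add_le _ _
  have hw3 : |w.im| ≤ 1 + |z.im| := by
    have h5 := Complex.abs_im_le_norm (w - z)
    rw [hw1, Complex.sub_im] at h5
    have := abs_add_le (w.im - z.im) z.im
    rw [sub_add_cancel] at this
    linarith
  calc ‖F w‖ ≤ 2 * (1 + K) * (1 + ‖w‖) * Real.exp (Real.pi * |w.im|) := hF w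
    _ ≤ 2 * (1 + K) * (2 * (1 + ‖z‖)) * Real.exp (Real.pi * (1 + |z.im|)) := by
        gcongr
        linarith [norm_nonneg z]
    _ = _ := by rw [mul_add Real.pi, Real.exp_add, mul_one]; ring

/-! ### Contour integration and vanishing of the weighted transform. -/

theorem integral_eq_zero_of_lower_decay {u : ℂ → ℂ} {C : ℝ}
    (hu : DifferentiableOn ℂ u {z | z.im ≤ 0})
    (hb : ∀ z : ℂ, z.im ≤ 0 → ‖u z‖ ≤ C / (1 + ‖z‖ ^ 2)) :
    ∫ x : ℝ, u x = 0 := by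
  have hC : 0 ≤ C := by
    have := (norm_nonneg _).trans (hb 0 (by simp))
    simpa using this
  have hc : Continuous fun x : ℝ => u x := by
    rw [← continuousOn_univ]
    exact hu.continuousOn.comp Complex.continuous_ofReal.continuousOn (fun x _ => by simp)
  have hint : Integrable fun x : ℝ => u x := by
    refine (integrable_inv_one_add_sq.const_mul C).mono' hc.aestronglyMeasurable
      (Filter.Eventually.of_forall fun x => ?_)
    simpa [div_eq_mul_inv] using hb x (by simp)
  have ht := intervalIntegral_tendsto_integral hint Filter.tendsto_neg_atTop_atBot Filter.tendsto_id
  refine tendsto_nhds_unique ht ?_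
  -- On the rectangle `[-R, R] × [-R, 0]` the three lower sides have total length `4R`, and `‖u‖ ≤ C
  -- / R²` there.
  refine squeeze_zero_norm' (a := fun R : ℝ => 4 * C / R) ?_
    (tendsto_const_nhds.div_atTop Filter.tendsto_id)
  filter_upwards [Filter.eventually_gt_atTop 0] with R hR
  have hbd : ∀ z : ℂ, z.im ≤ 0 → R ≤ ‖z‖ → ‖u z‖ ≤ C / R ^ 2 := fun z hz hz' =>
    (hb z hz).trans (by gcongr; nlinarith)
  have hrect := Complex.integral_boundary_rect_eq_zero_of_differentiableOn u
    (-R - R * Complex.I) R (hu.mono (fun z hz => by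
      have := hz.2
      simp [Set.uIcc_of_le, hR.le] at this
      exact this.2))
  simp only [Complex.sub_re, Complex.neg_re, Complex.ofReal_re, Complex.mul_re, Complex.I_re,
    mul_zero, Complex.ofReal_im, Complex.I_im, mul_one, sub_zero, Complex.sub_im, Complex.neg_im,
    neg_zero, Complex.mul_im, add_zero, zero_sub, Complex.ofReal_zero, zero_mul,
    Complex.ofReal_neg] at hrect
  have h1 : ‖∫ x in (-R)..R, u (x + -R * Complex.I)‖ ≤ C / R ^ 2 * |R - -R| := by
    refine intervalIntegral.norm_integral_le_of_norm_le_const fun x _ => hbd _ (by simp [hR.le]) ?_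
    have := Complex.abs_im_le_norm (x + -R * Complex.I)
    simpa [abs_of_pos hR] using this
  have h2 : ∀ r : ℝ, |r| = R →
      ‖∫ y in (-R)..(0 : ℝ), u (r + y * Complex.I)‖ ≤ C / R ^ 2 * |0 - -R| := by
    intro r hr
    refine intervalIntegral.norm_integral_le_of_norm_le_const fun y hy => hbd _ ?_ ?_
    · rw [Set.uIoc_of_le (by linarith)] at hy
      simpa using hy.2
    · have := Complex.abs_re_le_norm (r + y * Complex.I)
      simpa [hr] using this
  have h3 := h2 R (abs_of_pos hR)
  have h4 := h2 (-R) (by rw [abs_neg, abs_of_pos hR])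
  have e1 : |R - -R| = 2 * R := by rw [abs_of_pos] <;> linarith
  have e2 : |0 - -R| = R := by rw [abs_of_pos] <;> linarith
  rw [e1] at h1
  rw [e2] at h3 h4
  have e3 : C / R ^ 2 * R = C / R := by field_simp
  have e4 : C / R ^ 2 * (2 * R) = 2 * (C / R) := by field_simp
  rw [e3] at h3 h4
  rw [e4] at h1
  have e5 : (∫ x in (-R)..R, u x) = (∫ x in (-R)..R, u (x + -R * Complex.I)) +
      Complex.I * (∫ y in (-R)..(0 : ℝ), u (R + y * Complex.I)) -
      Complex.I * (∫ y in (-R)..(0 : ℝ), u ((-R : ℝ) + y * Complex.I)) := by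
    simp only [smul_eq_mul, Complex.ofReal_neg] at hrect ⊢
    linear_combination -hrect
  simp only [id]
  rw [e5]
  refine (norm_sub_le _ _).trans ?_
  refine (add_le_add_left (norm_add_le _ _) _).trans ?_
  rw [norm_mul, norm_mul, Complex.norm_I, one_mul, one_mul]
  have : 4 * C / R = 4 * (C / R) := by ring
  linarith

theorem one_add_sq_le_norm_sub_sq {s : ℝ} (hs : s ^ 2 = 1) {z : ℂ} (hz : s * z.im ≤ 0) :
    1 + ‖z‖ ^ 2 ≤ ‖z - s * Complex.I‖ ^ 2 := by
  rw [← Complex.normSq_eq_norm_sq, ← Complex.normSq_eq_norm_sq, Complex.normSq_apply,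
    Complex.normSq_apply]
  simp
  nlinarith

/-- The sign `s = ±1` selects the lower or upper half-plane and puts the pole `s i` in the opposite
one. There `sξ ≥ 1/2` makes the character cancel `exp(π|Im z|)`, and the cube beats the linear
factor with quadratic decay to spare. -/
theorem norm_weighted_le {C s ξ : ℝ} (hC : 0 ≤ C) {g : ℂ → ℂ}
    (hg : ∀ z, ‖g z‖ ≤ C * (1 + ‖z‖) * Real.exp (Real.pi * |z.im|))
    (hs : s ^ 2 = 1) (hξ : 1 / 2 ≤ s * ξ) {z : ℂ} (hz : s * z.im ≤ 0) :
    ‖Complex.exp (-2 * Real.pi * z * ξ * Complex.I) * (g z / (z - s * Complex.I) ^ 3)‖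
      ≤ 2 * C / (1 + ‖z‖ ^ 2) := by
  have h0 := one_add_sq_le_norm_sub_sq hs hz
  set d := ‖z - s * Complex.I‖ with hd
  have hd1 : 1 + ‖z‖ ≤ 2 * d := by
    nlinarith [norm_nonneg z, norm_nonneg (z - s * Complex.I), sq_nonneg (‖z‖ - 1)]
  have hd0 : 0 < d := by linarith [norm_nonneg z]
  have hexp : ‖Complex.exp (-2 * Real.pi * z * ξ * Complex.I)‖ ≤
      Real.exp (-(Real.pi * |z.im|)) := by
    rw [Complex.norm_exp, Real.exp_le_exp]
    have e : (-2 * Real.pi * z * ξ * Complex.I).re = Real.pi * (2 * (ξ * z.im)) := by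
      simp
      ring
    rw [e, ← mul_neg]
    refine mul_le_mul_of_nonneg_left ?_ Real.pi_pos.le
    rcases (show s = 1 ∨ s = -1 by simpa using hs) with rfl | rfl
    · rw [one_mul] at hz hξ
      rw [abs_of_nonpos hz]
      nlinarith
    · rw [abs_of_nonneg (by linarith)]
      nlinarith
  rw [norm_mul, norm_div, norm_pow, ← hd]
  calc _ ≤ Real.exp (-(Real.pi * |z.im|)) *
        (C * (1 + ‖z‖) * Real.exp (Real.pi * |z.im|) / d ^ 3) := by
        gcongr
        exact hg z
    _ = C * ((1 + ‖z‖) / d) / d ^ 2 := by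
        rw [Real.exp_neg]
        field_simp
    _ ≤ C * 2 / d ^ 2 := by
        gcongr
        rwa [div_le_iff₀ hd0]
    _ ≤ _ := by
        rw [mul_comm C]
        gcongr

theorem integrable_weighted {s : ℝ} (hs : s ^ 2 = 1) {g : ℂ → ℂ} (hg : g ∈ PaleyWiener2) :
    Integrable fun x : ℝ => g x / (x - s * Complex.I) ^ 3 := by
  obtain ⟨C, hC, h⟩ := exists_norm_le_of_mem_PaleyWiener2 hg
  have hne : ∀ x : ℝ, (x : ℂ) - s * Complex.I ≠ 0 := fun x hx => by
    have := congrArg Complex.im hx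
    simp at this
    simp [this] at hs
  have hc : Continuous fun x : ℝ => g x / (x - s * Complex.I) ^ 3 :=
    (hg.1.1.continuous.comp Complex.continuous_ofReal).div (by fun_prop)
      fun x => pow_ne_zero _ (hne x)
  refine (integrable_inv_one_add_sq.const_mul (2 * C)).mono' hc.aestronglyMeasurable
    (Filter.Eventually.of_forall fun x => ?_)
  -- Any admissible `ξ` serves, the character being unimodular on the real line.
  have h1 := norm_weighted_le hC h hs (ξ := s / 2) (by nlinarith) (z := x) (by simp)
  have h2 : ‖Complex.exp (-2 * Real.pi * x * (s / 2 : ℝ) * Complex.I)‖ = 1 := by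
    rw [Complex.norm_exp]
    simp
  rw [norm_mul, h2, one_mul] at h1
  simpa [div_eq_mul_inv] using h1

theorem integral_weighted_eq_zero {s ξ : ℝ} (hs : s ^ 2 = 1) (hξ : 1 / 2 ≤ s * ξ) {g : ℂ → ℂ}
    (hg : g ∈ PaleyWiener2) :
    ∫ x : ℝ, Complex.exp (-2 * Real.pi * x * ξ * Complex.I) *
      (g x / (x - s * Complex.I) ^ 3) = 0 := by
  obtain ⟨C, hC, h⟩ := exists_norm_le_of_mem_PaleyWiener2 hg
  set u : ℂ → ℂ := fun z => Complex.exp (-2 * Real.pi * z * ξ * Complex.I) *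
      (g z / (z - s * Complex.I) ^ 3)
  have hb : ∀ z : ℂ, s * z.im ≤ 0 → ‖u z‖ ≤ 2 * C / (1 + ‖z‖ ^ 2) := fun z hz =>
    norm_weighted_le hC h hs hξ hz
  have hd : ∀ z : ℂ, s * z.im ≤ 0 → DifferentiableAt ℂ u z := fun z hz => by
    have hne : z - s * Complex.I ≠ 0 := fun h0 => by
      have h1 := one_add_sq_le_norm_sub_sq hs hz
      rw [h0] at h1
      simp at h1
      nlinarith [sq_nonneg ‖z‖]
    exact DifferentiableAt.mul (by fun_prop)
      ((hg.1.1 z).div (by fun_prop) (pow_ne_zero _ hne))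
  rcases (show s = 1 ∨ s = -1 by simpa using hs) with rfl | rfl
  · exact integral_eq_zero_of_lower_decay (u := u)
      (fun z hz => (hd z (by simpa using hz)).differentiableWithinAt)
      fun z hz => hb z (by simpa using hz)
  · have := integral_eq_zero_of_lower_decay (u := fun z => u (-z)) (C := 2 * C)
      (fun z hz => ((hd (-z) (by simpa using hz)).comp z
        differentiableAt_id.neg).differentiableWithinAt)
      fun z hz => by simpa using hb (-z) (by simpa using hz)
    rw [← integral_neg_eq_self]
    simpa [u] using this

/-! ### Duality for the Fourier transform and the support of the spectrum. -/

open scoped FourierTransform SchwartzMap in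
theorem integral_fourier_mul_eq_of_integrable {f h : ℝ → ℂ} (hf : Integrable f)
    (hh : Integrable h) : ∫ ξ, 𝓕 f ξ * h ξ = ∫ x, f x * 𝓕 h x := by
  simpa using! VectorFourier.integral_fourierIntegral_smul_eq_flip (L := innerₗ ℝ)
    Real.continuous_fourierChar continuous_inner hf hh

open scoped FourierTransform SchwartzMap in
theorem integral_fourierInv_mul_eq_of_integrable {f h : ℝ → ℂ} (hf : Integrable f)
    (hh : Integrable h) : ∫ ξ, 𝓕⁻ f ξ * h ξ = ∫ x, f x * 𝓕⁻ h x := by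
  have := integral_fourier_mul_eq_of_integrable hf hh.comp_neg
  simp only [Real.fourierInv_eq_fourier_neg]
  rw [← integral_neg_eq_self]
  simp only [neg_neg]
  rw [this]
  refine integral_congr_ae (Filter.Eventually.of_forall fun x => ?_)
  simp only
  rw [← Real.fourierInv_eq_fourier_neg, Real.fourierInv_eq_fourier_comp_neg]

/-- The differential operator whose Fourier symbol is `x - s i`. -/
noncomputable def shiftDeriv (s : ℝ) (φ : SchwartzMap ℝ ℂ) : SchwartzMap ℝ ℂ :=
  (2 * Real.pi * Complex.I)⁻¹ • SchwartzMap.derivCLM ℂ ℂ φ - (s * Complex.I) • φ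

open scoped FourierTransform SchwartzMap in
theorem fourier_shiftDeriv (s : ℝ) (φ : 𝓢(ℝ, ℂ)) (x : ℝ) :
    𝓕 (shiftDeriv s φ) x = (x - s * Complex.I) * 𝓕 φ x := by
  have h1 : 𝓕 (SchwartzMap.derivCLM ℂ ℂ φ) x = (2 * Real.pi * Complex.I * x) * 𝓕 φ x := by
    rw [SchwartzMap.fourier_coe, SchwartzMap.fourier_coe]
    have h2 : (SchwartzMap.derivCLM ℂ ℂ φ : ℝ → ℂ) = deriv φ := by
      ext x
      simp
    rw [h2, Real.fourier_deriv φ.integrable φ.differentiable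
      (h2 ▸ (SchwartzMap.derivCLM ℂ ℂ φ).integrable)]
    simp
  have h3 : 𝓕 (shiftDeriv s φ) = (2 * Real.pi * Complex.I)⁻¹ • 𝓕 (SchwartzMap.derivCLM ℂ ℂ φ)
      - (s * Complex.I) • 𝓕 φ := by
    simp only [shiftDeriv, ← SchwartzMap.fourierTransformCLM_apply (𝕜 := ℂ), map_sub, map_smul]
  rw [h3]
  simp only [sub_apply, smul_apply, smul_eq_mul, h1]
  have : (Real.pi : ℂ) ≠ 0 := by exact_mod_cast Real.pi_ne_zero
  field_simp [Complex.I_ne_zero]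

theorem tsupport_shiftDeriv_subset (s : ℝ) (φ : SchwartzMap ℝ ℂ) :
    tsupport (shiftDeriv s φ) ⊆ tsupport φ := by
  refine closure_minimal (fun x hx => ?_) (isClosed_tsupport _)
  by_contra h
  have h1 : φ x = 0 := image_eq_zero_of_notMem_tsupport h
  have h2 : deriv φ x = 0 := by
    by_contra h3
    exact h (support_deriv_subset h3)
  exact hx (by simp [shiftDeriv, h1, h2])

-- The weight moves onto the test function: `ψ` satisfies `𝓕 ψ = (x - s i)³ 𝓕 φ`, so `g` can be
-- replaced by the integrable `g / (x - s i)³`, whose transform vanishes on the support of `ψ`.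
open scoped FourierTransform SchwartzMap in
theorem integral_fourier_mul_eq_zero {s : ℝ} (hs : s ^ 2 = 1) {g : ℂ → ℂ}
    (hg : g ∈ PaleyWiener2) (φ : 𝓢(ℝ, ℂ)) (hφ : tsupport φ ⊆ {ξ | 1 / 2 < s * ξ}) :
    ∫ x : ℝ, 𝓕 φ x * g x = 0 := by
  set ψ := shiftDeriv s (shiftDeriv s (shiftDeriv s φ))
  have hψ : tsupport ψ ⊆ {ξ | 1 / 2 < s * ξ} :=
    (tsupport_shiftDeriv_subset s _).trans <| (tsupport_shiftDeriv_subset s _).trans <|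
      (tsupport_shiftDeriv_subset s _).trans hφ
  set u : ℝ → ℂ := fun x => g x / (x - s * Complex.I) ^ 3
  have hne : ∀ x : ℝ, (x : ℂ) - s * Complex.I ≠ 0 := fun x hx => by
    have := congrArg Complex.im hx
    simp at this
    simp [this] at hs
  have h1 : ∫ x : ℝ, 𝓕 φ x * g x = ∫ x : ℝ, 𝓕 (ψ : ℝ → ℂ) x * u x := by
    refine integral_congr_ae (Filter.Eventually.of_forall fun x => ?_)
    simp only [← SchwartzMap.fourier_coe, ψ, fourier_shiftDeriv, u]
    have := hne x
    field_simp
  rw [h1, integral_fourier_mul_eq_of_integrable ψ.integrable (integrable_weighted hs hg)]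
  refine integral_eq_zero_of_ae (Filter.Eventually.of_forall fun ξ => ?_)
  by_cases h : ξ ∈ tsupport ψ
  · have h2 := integral_weighted_eq_zero hs (le_of_lt (hψ h)) hg
    have h3 : 𝓕 u ξ = 0 := by
      rw [Real.fourier_eq', ← h2]
      refine integral_congr_ae (Filter.Eventually.of_forall fun x => ?_)
      simp only [u, smul_eq_mul]
      congr 2
      simp
      ring
    exact mul_eq_zero_of_right _ h3
  · simp [image_eq_zero_of_notMem_tsupport h]

open scoped FourierTransform SchwartzMap in
theorem integral_mul_fourier_Lp (f : Lp (α := ℝ) ℂ 2) (φ : 𝓢(ℝ, ℂ)) :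
    ∫ x, φ x * (𝓕 f : Lp (α := ℝ) ℂ 2) x = ∫ x, 𝓕 φ x * f x := by
  have := congrArg (fun T => T φ) (Lp.fourier_toTemperedDistribution_eq f)
  simpa [Lp.toTemperedDistribution_apply] using this.symm

open scoped FourierTransform SchwartzMap in
theorem integral_mul_fourierInv_Lp (f : Lp (α := ℝ) ℂ 2) (φ : 𝓢(ℝ, ℂ)) :
    ∫ x, φ x * (𝓕⁻ f : Lp (α := ℝ) ℂ 2) x = ∫ x, 𝓕⁻ φ x * f x := by
  have := congrArg (fun T => T φ) (Lp.fourierInv_toTemperedDistribution_eq f)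
  simpa [Lp.toTemperedDistribution_apply] using this.symm

open scoped FourierTransform SchwartzMap ContDiff in
/-- A compactly supported smooth real function defines a complex-valued Schwartz function. -/
theorem exists_schwartz_eq_ofReal {h : ℝ → ℝ} (hd : ContDiff ℝ ∞ h) (hc : HasCompactSupport h) :
    ∃ φ : 𝓢(ℝ, ℂ), (φ : ℝ → ℂ) = fun x => (h x : ℂ) := by
  have hc' : HasCompactSupport fun x => (h x : ℂ) :=
    hc.comp_left (g := fun x : ℝ => (x : ℂ)) (by simp)
  exact ⟨hc'.toSchwartzMap (Complex.ofRealCLM.contDiff.comp hd), rfl⟩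

theorem locallyIntegrable_Lp_two (f : Lp (α := ℝ) ℂ 2) : LocallyIntegrable f :=
  (Lp.memLp f).locallyIntegrable (by norm_num)

open scoped FourierTransform SchwartzMap in
theorem fourier_Lp_ae_eq_zero {g : ℂ → ℂ} (hg : g ∈ PaleyWiener2) :
    ∀ᵐ ξ : ℝ, ξ ∉ Set.Icc (-1 / 2 : ℝ) (1 / 2) →
      (𝓕 (hg.2.toLp _ : Lp (α := ℝ) ℂ 2) : Lp (α := ℝ) ℂ 2) ξ = 0 := by
  have key : ∀ s : ℝ, s ^ 2 = 1 → ∀ᵐ ξ : ℝ, ξ ∈ {ξ | 1 / 2 < s * ξ} →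
      (𝓕 (hg.2.toLp _ : Lp (α := ℝ) ℂ 2) : Lp (α := ℝ) ℂ 2) ξ = 0 := by
    intro s hs
    have ho : IsOpen {ξ : ℝ | 1 / 2 < s * ξ} := isOpen_lt continuous_const (by fun_prop)
    refine ho.ae_eq_zero_of_integral_contDiff_smul_eq_zero
      ((locallyIntegrable_Lp_two _).locallyIntegrableOn _) fun h hd hc hsupp => ?_
    obtain ⟨φ, hφ⟩ := exists_schwartz_eq_ofReal hd hc
    have h1 := integral_mul_fourier_Lp (hg.2.toLp _) φ
    have h2 : tsupport φ ⊆ {ξ | 1 / 2 < s * ξ} := by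
      rw [hφ]
      exact (tsupport_comp_subset (g := fun x : ℝ => (x : ℂ)) (by simp) h).trans hsupp
    have h3 := integral_fourier_mul_eq_zero hs hg φ h2
    have h4 : ∫ x, 𝓕 φ x * (hg.2.toLp _ : Lp (α := ℝ) ℂ 2) x = ∫ x : ℝ, 𝓕 φ x * g x := by
      refine integral_congr_ae ?_
      filter_upwards [hg.2.coeFn_toLp] with x hx
      rw [hx]
    rw [h4, h3] at h1
    simpa [hφ] using h1
  filter_upwards [key 1 (by norm_num), key (-1) (by norm_num)] with ξ h1 h2 hξ
  rw [Set.mem_Icc, not_and_or, not_le, not_le] at hξ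
  rcases hξ with h | h
  · exact h2 (show 1 / 2 < _ by linarith)
  · exact h1 (show 1 / 2 < _ by linarith)

-- Reconciles the `L²` inverse transform with the integral formula: both give the same pairing with
-- smooth compactly supported functions.
open scoped FourierTransform SchwartzMap in
theorem fourierInv_toLp_ae_eq {u : ℝ → ℂ} (h1 : Integrable u) (h2 : MemLp u 2) :
    (𝓕⁻ (h2.toLp u : Lp (α := ℝ) ℂ 2) : Lp (α := ℝ) ℂ 2) =ᵐ[volume] 𝓕⁻ u := by
  have hcont : Continuous (𝓕⁻ u) :=
    VectorFourier.fourierIntegral_continuous Real.continuous_fourierChar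
      (L := -innerₗ ℝ) (by simpa using! continuous_inner.neg) h1
  refine ae_eq_of_integral_contDiff_smul_eq (locallyIntegrable_Lp_two _)
    hcont.locallyIntegrable fun h hd hc => ?_
  obtain ⟨φ, hφ⟩ := exists_schwartz_eq_ofReal hd hc
  have h3 := integral_mul_fourierInv_Lp (h2.toLp u) φ
  have h4 : ∫ x, 𝓕⁻ φ x * (h2.toLp u : Lp (α := ℝ) ℂ 2) x = ∫ x : ℝ, 𝓕⁻ (φ : ℝ → ℂ) x * u x := by
    refine integral_congr_ae ?_
    filter_upwards [h2.coeFn_toLp] with x hx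
    rw [hx, SchwartzMap.fourierInv_coe]
  rw [h4, integral_fourierInv_mul_eq_of_integrable φ.integrable h1] at h3
  simpa [hφ] using h3

theorem integral_norm_sq_Lp (f : Lp (α := ℝ) ℂ 2) : ∫ x, ‖f x‖ ^ 2 = ‖f‖ ^ 2 := by
  have h := congrArg Complex.re (L2.inner_def (𝕜 := ℂ) f f)
  rw [inner_self_eq_norm_sq_to_K] at h
  have h2 : ∫ x, inner ℂ (f x) (f x) = ((∫ x, ‖f x‖ ^ 2 : ℝ) : ℂ) := by
    rw [← integral_complex_ofReal]
    simp [inner_self_eq_norm_sq_to_K]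
  rw [h2] at h
  rw [Complex.ofReal_re] at h
  rw [← h]
  norm_cast

open scoped FourierTransform SchwartzMap in
theorem memLp_fourierInv {u : ℝ → ℂ} (h1 : Integrable u) (h2 : MemLp u 2) :
    MemLp (𝓕⁻ u) 2 ∧ ∫ x, ‖𝓕⁻ u x‖ ^ 2 = ∫ ξ, ‖u ξ‖ ^ 2 := by
  have h := fourierInv_toLp_ae_eq h1 h2
  refine ⟨(Lp.memLp _).ae_eq h, ?_⟩
  have e1 : ∫ x, ‖𝓕⁻ u x‖ ^ 2 = ∫ x, ‖(𝓕⁻ (h2.toLp u : Lp (α := ℝ) ℂ 2) : Lp (α := ℝ) ℂ 2) x‖ ^ 2 :=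
    integral_congr_ae (by filter_upwards [h] with x hx; rw [hx])
  have e2 : ∫ x, ‖u x‖ ^ 2 = ∫ x, ‖(h2.toLp u : Lp (α := ℝ) ℂ 2) x‖ ^ 2 :=
    integral_congr_ae (by filter_upwards [h2.coeFn_toLp] with x hx; rw [hx])
  rw [e1, e2, integral_norm_sq_Lp, integral_norm_sq_Lp]
  congr 1
  exact (Lp.fourierTransformₗᵢ ℝ ℂ).symm.norm_map _

open scoped FourierTransform in
/-- Paley-Wiener: on the real line `g` and `g'` are inverse Fourier transforms of functions
supported in `[-1/2, 1/2]`. -/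
theorem exists_spectrum {g : ℂ → ℂ} (hg : g ∈ PaleyWiener2) :
    ∃ u : ℝ → ℂ, MemLp u 2 ∧ Integrable u ∧ (∀ ξ, ξ ∉ Set.Icc (-1 / 2 : ℝ) (1 / 2) → u ξ = 0) ∧
      (∀ x : ℝ, g x = 𝓕⁻ u x) ∧
      ∀ x : ℝ, deriv g x = 𝓕⁻ (fun ξ : ℝ => (2 * Real.pi * Complex.I * ξ) * u ξ) x := by
  set v : Lp (α := ℝ) ℂ 2 := 𝓕 (hg.2.toLp _ : Lp (α := ℝ) ℂ 2) with hv
  -- Truncation alters `v` only on a null set; the bounded support makes `u` and `ξ u` integrable.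
  set u : ℝ → ℂ := (Set.Icc (-1 / 2 : ℝ) (1 / 2)).indicator v with hu
  have huv : u =ᵐ[volume] v := by
    filter_upwards [fourier_Lp_ae_eq_zero hg] with ξ hξ
    by_cases h : ξ ∈ Set.Icc (-1 / 2 : ℝ) (1 / 2)
    · rw [hu, Set.indicator_of_mem h]
    · rw [hu, Set.indicator_of_notMem h, hv, hξ h]
  have hu2 : MemLp u 2 := (Lp.memLp v).ae_eq huv.symm
  have hu1 : Integrable u :=
    (integrable_indicator_iff measurableSet_Icc).2
      ((locallyIntegrable_Lp_two v).integrableOn_isCompact isCompact_Icc)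
  have hxu : Integrable fun ξ : ℝ => ξ • u ξ := by
    refine (hu1.norm.const_mul (1 / 2)).mono'
      (continuous_id.aestronglyMeasurable.smul hu1.1) (Filter.Eventually.of_forall fun ξ => ?_)
    by_cases h : ξ ∈ Set.Icc (-1 / 2 : ℝ) (1 / 2)
    · rw [norm_smul, Real.norm_eq_abs]
      have : |ξ| ≤ 1 / 2 := abs_le.2 ⟨by linarith [h.1], h.2⟩
      gcongr
    · have : u ξ = 0 := Set.indicator_of_notMem h _
      simp [this]
  have hF := Real.hasDerivAt_fourier hu1 hxu
  have hcont : Continuous (𝓕⁻ u) := by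
    have h1 : Continuous (𝓕 u) := continuous_iff_continuousAt.2 fun x => (hF x).continuousAt
    have h2 : 𝓕⁻ u = fun x => 𝓕 u (-x) := funext fun x => Real.fourierInv_eq_fourier_neg u x
    rw [h2]
    exact h1.comp continuous_neg
  have hae : (fun x : ℝ => g x) =ᵐ[volume] 𝓕⁻ u := by
    have h1 := fourierInv_toLp_ae_eq hu1 hu2
    have h2 : hu2.toLp u = v := by
      rw [← Lp.toLp_coeFn v (Lp.memLp v)]
      exact MemLp.toLp_congr _ _ huv
    rw [h2, hv, FourierTransform.fourierInv_fourier_eq] at h1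
    exact hg.2.coeFn_toLp.symm.trans h1
  -- Continuity upgrades almost everywhere to everywhere, which evaluation at `0` requires.
  have heq : (fun x : ℝ => g x) = 𝓕⁻ u :=
    (hg.1.1.continuous.comp Complex.continuous_ofReal).ae_eq_iff_eq volume hcont |>.1 hae
  refine ⟨u, hu2, hu1, fun ξ h => Set.indicator_of_notMem h _, congrFun heq, fun x => ?_⟩
  have hd1 : HasDerivAt (fun x : ℝ => g x) (deriv g x) x :=
    (hg.1.1 x).hasDerivAt.comp_ofReal
  have hd2 : HasDerivAt (𝓕⁻ u)
      (-𝓕 (fun x : ℝ => (-2 * Real.pi * Complex.I * x) • u x) (-x)) x := by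
    have h2 : 𝓕⁻ u = fun x => 𝓕 u (-x) := funext fun x => Real.fourierInv_eq_fourier_neg u x
    rw [h2]
    have h3 := (hF (-x)).scomp x (hasDerivAt_neg x)
    rw [neg_one_smul] at h3
    exact h3
  rw [heq] at hd1
  rw [hd1.unique hd2, Real.fourierInv_eq_fourier_neg, Real.fourier_eq, Real.fourier_eq,
    ← integral_neg]
  refine integral_congr_ae (Filter.Eventually.of_forall fun ξ => ?_)
  simp only [smul_eq_mul, ← smul_neg]
  congr 1
  ring

/-! ### The weighted inequality and the energy identities. -/

theorem integral_inv_one_sub_sq {c : ℝ} (hc : 0 < c) (hc2 : c < 2) :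
    ∫ ξ in (-1 / 2 : ℝ)..(1 / 2), (1 - (c * ξ) ^ 2)⁻¹ =
      1 / c * Real.log ((1 + c / 2) / (1 - c / 2)) := by
  have hpos : ∀ ξ ∈ Set.uIcc (-1 / 2 : ℝ) (1 / 2), 0 < 1 + c * ξ ∧ 0 < 1 - c * ξ := by
    intro ξ h
    rw [Set.uIcc_of_le (by norm_num)] at h
    constructor <;> nlinarith [h.1, h.2]
  have hd : ∀ ξ ∈ Set.uIcc (-1 / 2 : ℝ) (1 / 2),
      HasDerivAt (fun ξ => 1 / (2 * c) * (Real.log (1 + c * ξ) - Real.log (1 - c * ξ)))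
        ((1 - (c * ξ) ^ 2)⁻¹) ξ := by
    intro ξ h
    obtain ⟨h1, h2⟩ := hpos ξ h
    have e1 := (((hasDerivAt_id ξ).const_mul c).const_add 1).log h1.ne'
    have e2 := (((hasDerivAt_id ξ).const_mul c).const_sub 1).log h2.ne'
    refine ((e1.sub e2).const_mul (1 / (2 * c))).congr_deriv ?_
    have h3 : 1 - (c * ξ) ^ 2 = (1 + c * ξ) * (1 - c * ξ) := by ring
    rw [h3]
    simp only [id]
    field_simp
    ring
  rw [intervalIntegral.integral_eq_sub_of_hasDerivAt hd]
  · rw [Real.log_div (by linarith) (by linarith)]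
    have e1 : 1 + c * (-1 / 2) = 1 - c / 2 := by ring
    have e2 : 1 - c * (-1 / 2) = 1 + c / 2 := by ring
    have e3 : 1 + c * (1 / 2) = 1 + c / 2 := by ring
    have e4 : 1 - c * (1 / 2) = 1 - c / 2 := by ring
    rw [e1, e2, e3, e4]
    field_simp
    ring
  · refine ContinuousOn.intervalIntegrable (ContinuousOn.inv₀ (by fun_prop) fun ξ h => ?_)
    obtain ⟨h1, h2⟩ := hpos ξ h
    nlinarith [mul_pos h1 h2]

/-- Weighted Cauchy-Schwarz inequality for a function of integral one. -/
theorem inv_integral_inv_le {S : Set ℝ} (hS : MeasurableSet S) {p : ℝ → ℝ} {u : ℝ → ℂ}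
    (hp : ∀ ξ ∈ S, 0 < p ξ) (hpi : IntegrableOn (fun ξ => (p ξ)⁻¹) S)
    (hK : 0 < ∫ ξ in S, (p ξ)⁻¹) (hu : IntegrableOn u S)
    (hE : IntegrableOn (fun ξ => p ξ * ‖u ξ‖ ^ 2) S) (h1 : ∫ ξ in S, u ξ = 1) :
    (∫ ξ in S, (p ξ)⁻¹)⁻¹ ≤ ∫ ξ in S, p ξ * ‖u ξ‖ ^ 2 := by
  set K := ∫ ξ in S, (p ξ)⁻¹ with hKd
  have h2 : (1 : ℝ) ≤ ∫ ξ in S, ‖u ξ‖ := by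
    have := norm_integral_le_integral_norm (μ := volume.restrict S) u
    rwa [h1, norm_one] at this
  -- Pointwise AM-GM, scaled by `K` so that the second term integrates to exactly `1/2`; with `h2`
  -- this leaves `1 ≤ K ∫ p|u|²`.
  have h3 : ∫ ξ in S, ‖u ξ‖ ≤
      ∫ ξ in S, (K / 2 * (p ξ * ‖u ξ‖ ^ 2) + (2 * K)⁻¹ * (p ξ)⁻¹) := by
    refine setIntegral_mono_on hu.norm ((hE.const_mul _).add (hpi.const_mul _)) hS fun ξ h => ?_
    have hpξ := hp ξ h
    have : K / 2 * (p ξ * ‖u ξ‖ ^ 2) + (2 * K)⁻¹ * (p ξ)⁻¹ - ‖u ξ‖ =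
        (K * p ξ * ‖u ξ‖ - 1) ^ 2 / (2 * K * p ξ) := by
      field_simp
      ring
    have h4 : 0 ≤ (K * p ξ * ‖u ξ‖ - 1) ^ 2 / (2 * K * p ξ) := by positivity
    linarith
  rw [integral_add (hE.const_mul _) (hpi.const_mul _), integral_const_mul, integral_const_mul,
    ← hKd] at h3
  have h5 : (2 * K)⁻¹ * K = 1 / 2 := by field_simp
  rw [h5] at h3
  rw [inv_le_iff_one_le_mul₀ hK]
  linarith

open scoped FourierTransform in
theorem exists_spectrum_energy {g : ℂ → ℂ} (hg : g ∈ PaleyWiener2) :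
    ∃ u : ℝ → ℂ, MemLp u 2 ∧ Integrable u ∧ (∀ ξ, ξ ∉ Set.Icc (-1 / 2 : ℝ) (1 / 2) → u ξ = 0) ∧
      g 0 = ∫ ξ, u ξ ∧ (∫ x : ℝ, ‖g x‖ ^ 2) = ∫ ξ, ‖u ξ‖ ^ 2 ∧
      Integrable (fun x : ℝ => ‖deriv g x‖ ^ 2) ∧
      (∫ x : ℝ, ‖deriv g x‖ ^ 2) = ∫ ξ, (2 * Real.pi * ξ) ^ 2 * ‖u ξ‖ ^ 2 ∧
      Integrable fun ξ => (2 * Real.pi * ξ) ^ 2 * ‖u ξ‖ ^ 2 := by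
  obtain ⟨u, hu2, hu1, hsupp, hgu, hdg⟩ := exists_spectrum hg
  set w : ℝ → ℂ := fun ξ => (2 * Real.pi * Complex.I * ξ) * u ξ with hw
  have hwn : ∀ ξ, ‖w ξ‖ = |2 * Real.pi * ξ| * ‖u ξ‖ := fun ξ => by
    simp [hw, abs_mul]
  have hwle : ∀ ξ, ‖w ξ‖ ≤ Real.pi * ‖u ξ‖ := fun ξ => by
    by_cases h : ξ ∈ Set.Icc (-1 / 2 : ℝ) (1 / 2)
    · rw [hwn]
      gcongr
      rw [abs_le]
      constructor <;> nlinarith [h.1, h.2, Real.pi_pos]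
    · simp [hw, hsupp ξ h]
  have hwm : AEStronglyMeasurable w volume :=
    Continuous.aestronglyMeasurable (by fun_prop) |>.mul hu1.1
  have hw1 : Integrable w :=
    (hu1.norm.const_mul Real.pi).mono' hwm (Filter.Eventually.of_forall hwle)
  have hw2 : MemLp w 2 := hu2.of_le_mul hwm (Filter.Eventually.of_forall hwle)
  have hwsq : ∀ ξ, ‖w ξ‖ ^ 2 = (2 * Real.pi * ξ) ^ 2 * ‖u ξ‖ ^ 2 := fun ξ => by
    rw [hwn, mul_pow, sq_abs]
  obtain ⟨hm, hE⟩ := memLp_fourierInv hw1 hw2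
  refine ⟨u, hu2, hu1, hsupp, ?_, ?_, ?_, ?_, ?_⟩
  · have := hgu 0
    rw [Real.fourierInv_eq] at this
    simpa using this
  · simp only [hgu]
    exact (memLp_fourierInv hu1 hu2).2
  · simp only [hdg]
    exact (memLp_two_iff_integrable_sq_norm hm.1).1 hm
  · simp only [hdg, ← hwsq]
    exact hE
  · simp only [← hwsq]
    exact (memLp_two_iff_integrable_sq_norm hwm).1 hw2

theorem mainTheorem6 :
    -- the inequality for each fixed `0 < a < 1 / π²`
    (∀ a : ℝ, 0 < a → a < 1 / Real.pi ^ 2 →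
      ∀ g : ℂ → ℂ, g ∈ PaleyWiener2 → g 0 = 1 →
        Integrable (fun x : ℝ => ‖deriv g (x : ℂ)‖ ^ 2) volume ∧
        a * (∫ x : ℝ, ‖deriv g (x : ℂ)‖ ^ 2) +
            (1 / (2 * Real.pi * Real.sqrt a) *
              Real.log ((1 + Real.sqrt a * Real.pi) / (1 - Real.sqrt a * Real.pi)))⁻¹
          ≤ ∫ x : ℝ, ‖g (x : ℂ)‖ ^ 2) ∧
    -- the `L²` Bernstein inequality
    (∀ g : ℂ → ℂ, g ∈ PaleyWiener2 →
        Integrable (fun x : ℝ => ‖deriv g (x : ℂ)‖ ^ 2) volume ∧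
        (∫ x : ℝ, ‖deriv g (x : ℂ)‖ ^ 2) ≤ Real.pi ^ 2 * ∫ x : ℝ, ‖g (x : ℂ)‖ ^ 2) := by
  refine ⟨fun a ha ha' g hg hg0 => ?_, fun g hg => ?_⟩
  · obtain ⟨u, hu2, hu1, hsupp, hI, hgE, hdi, hdE, hdu⟩ := exists_spectrum_energy hg
    refine ⟨hdi, ?_⟩
    have hsq : Integrable fun ξ => ‖u ξ‖ ^ 2 := (memLp_two_iff_integrable_sq_norm hu2.1).1 hu2
    set S := Set.Icc (-1 / 2 : ℝ) (1 / 2)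
    -- With this `c`, `1 - (cξ)²` is the spectral weight of `∫|g|² - a∫|g'|²`, and `a < 1/π²` says
    -- exactly `c < 2`.
    set c := 2 * Real.pi * Real.sqrt a with hc
    have hsa := Real.sqrt_pos.2 ha
    have hπ := Real.pi_pos
    have hc0 : 0 < c := by positivity
    have hc_sq : c ^ 2 = a * (2 * Real.pi) ^ 2 := by
      rw [hc, mul_pow, Real.sq_sqrt ha.le, mul_comm]
    have hc2 : c < 2 := by
      rw [lt_div_iff₀ (by positivity)] at ha'
      nlinarith
    have hp : ∀ ξ ∈ S, 0 < 1 - (c * ξ) ^ 2 := by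
      intro ξ hξ
      have h1 : 0 < 1 - c * ξ := by nlinarith [hξ.1, hξ.2]
      have h2 : 0 < 1 + c * ξ := by nlinarith [hξ.1, hξ.2]
      nlinarith [mul_pos h1 h2]
    have hK : ∫ ξ in S, (1 - (c * ξ) ^ 2)⁻¹ = 1 / c *
        Real.log ((1 + Real.sqrt a * Real.pi) / (1 - Real.sqrt a * Real.pi)) := by
      rw [integral_Icc_eq_integral_Ioc, ← intervalIntegral.integral_of_le (by norm_num),
        integral_inv_one_sub_sq hc0 hc2]
      have : c / 2 = Real.sqrt a * Real.pi := by rw [hc]; ring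
      rw [this]
    have hKpos : 0 < ∫ ξ in S, (1 - (c * ξ) ^ 2)⁻¹ := by
      have hlt : Real.sqrt a * Real.pi < 1 := by
        have : c / 2 = Real.sqrt a * Real.pi := by rw [hc]; ring
        linarith
      rw [hK]
      refine mul_pos (by positivity) (Real.log_pos ?_)
      rw [lt_div_iff₀ (by linarith)]
      nlinarith [mul_pos hsa hπ]
    have hpi : IntegrableOn (fun ξ => (1 - (c * ξ) ^ 2)⁻¹) S :=
      ContinuousOn.integrableOn_Icc (ContinuousOn.inv₀ (by fun_prop) fun ξ h => (hp ξ h).ne')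
    have hEeq : ∀ ξ, (1 - (c * ξ) ^ 2) * ‖u ξ‖ ^ 2 =
        ‖u ξ‖ ^ 2 - a * ((2 * Real.pi * ξ) ^ 2 * ‖u ξ‖ ^ 2) := by
      intro ξ
      rw [mul_pow, hc_sq]
      ring
    have hEi : Integrable fun ξ => (1 - (c * ξ) ^ 2) * ‖u ξ‖ ^ 2 := by
      simp only [hEeq]
      exact hsq.sub (hdu.const_mul a)
    have h1 : ∫ ξ in S, u ξ = 1 := by
      rw [setIntegral_eq_integral_of_forall_compl_eq_zero hsupp, ← hI, hg0]
    have hmain := inv_integral_inv_le measurableSet_Icc hp hpi hKpos hu1.integrableOn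
      hEi.integrableOn h1
    rw [hK, setIntegral_eq_integral_of_forall_compl_eq_zero
      (fun ξ h => by simp [hsupp ξ h])] at hmain
    simp only [hEeq] at hmain
    rw [integral_sub hsq (hdu.const_mul a), integral_const_mul, ← hdE, ← hgE] at hmain
    linarith
  · obtain ⟨u, hu2, hu1, hsupp, hI, hgE, hdi, hdE, hdu⟩ := exists_spectrum_energy hg
    have hsq : Integrable fun ξ => ‖u ξ‖ ^ 2 := (memLp_two_iff_integrable_sq_norm hu2.1).1 hu2
    refine ⟨hdi, ?_⟩
    rw [hgE, hdE, ← integral_const_mul]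
    refine integral_mono hdu (hsq.const_mul _) fun ξ => ?_
    by_cases h : ξ ∈ Set.Icc (-1 / 2 : ℝ) (1 / 2)
    · have h1 : ξ ^ 2 ≤ 1 / 4 := by nlinarith [h.1, h.2]
      have h2 : (2 * Real.pi * ξ) ^ 2 ≤ Real.pi ^ 2 := by nlinarith [sq_nonneg Real.pi]
      exact mul_le_mul_of_nonneg_right h2 (by positivity)
    · simp [hsupp ξ h]
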